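/- For $\theta\in\Theta=[0,\infty)$ let $f_\theta$ be the probability density on $\mathbb R$ that vanishes outside $[0,1]$ and is given on $[0,1]$ by \[ f_\theta(x)=\frac{1+\cos(\theta x)}{1+\sin(\theta)/\theta}\quad(\theta>0),\qquad f_0(x)=1, \] and let $F_\theta$ be the corresponding probability measure. Given a prior $\Pi$, i.e. a Borel probability measure on $[0,\infty)$, and observations $X_1,X_2,\dots$, the posterior is \[ \Pi(B\mid X_{1:n})=\frac{\int_B\prod_{i=1}^n f_\theta(X_i)\,\Pi(\mathrm d\theta)}{\int_{[0,\infty)}\prod_{i=1}^n f_{\theta}(X_i)\,\Pi(\mathrm d\theta)} . \] Suppose that $\Pi$ has full support on $[0,\infty)$, that is, $\Pi(U)>0$ for every nonempty relatively open $U\subseteq[0,\infty)$. Then the posterior is consistent at every $\theta_\star>0$: if $X_1,X_2,\dots$ are i.i.d. from $F_{\theta_\star}$, then almost surely (with respect to $F_{\theta_\star}^\infty$) the posterior is a well-defined probability measure for every $n$, and for every $\varepsilon>0$, \[ \lim_{n\to\infty}\Pi\bigl(\{\theta\ge 0:|\theta-\theta_\star|\ge\varepsilon\}\mid X_{1:n}\bigr)=0\qquad\text{a.s.-}F_{\theta_\star}^\infty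 . \] -/

import Mathlib

open MeasureTheory Filter Topology
open scoped ENNReal NNReal

noncomputable section

/-! ### Bayesian inference in a dominated model on the real line -/

section Bayes

variable {Θ : Type*}

/-- The distribution `F_θ` on `ℝ` with Lebesgue density `f θ`. -/
def modelMeasure (f : Θ → ℝ → ℝ) (θ : Θ) : Measure ℝ :=
  volume.withDensity fun x => ENNReal.ofReal (f θ x)

/-- The likelihood `∏ f_θ(x_i)` of the first `n` observations of the sequence `x`. -/
def likelihood (f : Θ → ℝ → ℝ) (x : ℕ → ℝ) (n : ℕ) (θ : Θ) : ℝ≥0∞ :=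
  ∏ i ∈ Finset.range n, ENNReal.ofReal (f θ (x i))

/-- The posterior distribution given the first `n` observations of `x`, by Bayes' rule: the
measure with density `likelihood f x n` with respect to the prior, divided by
the normalizing constant `∫ likelihood f x n dprior`. -/
def bayesPosterior [MeasurableSpace Θ] (f : Θ → ℝ → ℝ) (prior : Measure Θ)
    (x : ℕ → ℝ) (n : ℕ) : Measure Θ :=
  (∫⁻ θ, likelihood f x n θ ∂prior)⁻¹ • prior.withDensity (likelihood f x n)

/-- Posterior consistency at `θs`: for every `ε > 0`, the posterior mass of the complement of the
`ε`-ball around `θs` tends to `0`, almost surely under the infinite product of `F_θs`. -/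
def PosteriorConsistentAt [MeasurableSpace Θ] [PseudoMetricSpace Θ] (f : Θ → ℝ → ℝ)
    (prior : Measure Θ) (θs : Θ) [IsProbabilityMeasure (modelMeasure f θs)] : Prop :=
  ∀ ε : ℝ, 0 < ε →
    ∀ᵐ x ∂(Measure.infinitePi fun _ : ℕ => modelMeasure f θs),
      Tendsto (fun n : ℕ => bayesPosterior f prior x n {θ | dist θ θs < ε}ᶜ) atTop (𝓝 0)

end Bayes

/-! ### The cosine model -/

/-- The cosine densities, with parameter space `[0, ∞)`:
`f_θ(x) = (1 + cos (θ x)) / (1 + sin θ / θ)` on `[0, 1]`, and `0` elsewhere. Since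
`Real.sinc θ = sin θ / θ` for `θ ≠ 0` and `Real.sinc 0 = 1`, one has `f_0 = 1` on `[0, 1]`. -/
def cosineDensity (θ : ℝ≥0) (x : ℝ) : ℝ :=
  (Set.Icc (0 : ℝ) 1).indicator
    (fun y => (1 + Real.cos ((θ : ℝ) * y)) / (1 + Real.sinc (θ : ℝ))) x

theorem one_add_sinc_pos (t : ℝ) : 0 < 1 + Real.sinc t := by
  have h : -1 < Real.sinc t := by
    by_cases ht : t = 0
    · subst ht; simp
    · rw [Real.sinc_of_ne_zero ht]
      have h1 : |Real.sin t / t| < 1 := by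
        rw [abs_div, div_lt_one (abs_pos.mpr ht)]
        exact Real.abs_sin_lt_abs ht
      exact (abs_lt.mp h1).1
  linarith

theorem integral_one_add_cos_mul (t : ℝ) :
    ∫ y in (0 : ℝ)..1, (1 + Real.cos (t * y)) = 1 + Real.sinc t := by
  rw [intervalIntegral.integral_add (by simp)
    (by apply Continuous.intervalIntegrable; fun_prop)]
  by_cases ht : t = 0
  · subst ht; simp
  · rw [intervalIntegral.integral_comp_mul_left (fun y => Real.cos y) ht, integral_cos,
      Real.sinc_of_ne_zero ht]
    simp
    field_simp

/-- Each cosine density integrates to one. -/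
instance isProbabilityMeasure_cosine (θ : ℝ≥0) :
    IsProbabilityMeasure (modelMeasure cosineDensity θ) := by
  constructor
  have hc := one_add_sinc_pos (θ : ℝ)
  have hf : (fun x => ENNReal.ofReal (cosineDensity θ x)) = (Set.Icc (0 : ℝ) 1).indicator
      (fun y => ENNReal.ofReal
        ((1 + Real.cos ((θ : ℝ) * y)) / (1 + Real.sinc (θ : ℝ)))) := by
    funext x
    by_cases hx : x ∈ Set.Icc (0 : ℝ) 1 <;> simp [cosineDensity, hx]
  rw [modelMeasure, withDensity_apply _ MeasurableSet.univ, Measure.restrict_univ, hf,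
    lintegral_indicator measurableSet_Icc, ← ofReal_integral_eq_lintegral_ofReal]
  · rw [integral_div, integral_Icc_eq_integral_Ioc, ← intervalIntegral.integral_of_le zero_le_one,
      integral_one_add_cos_mul, div_self hc.ne', ENNReal.ofReal_one]
  · apply Continuous.integrableOn_Icc
    fun_prop
  · refine Eventually.of_forall fun y => div_nonneg ?_ hc.le
    linarith [Real.neg_one_le_cos ((θ : ℝ) * y)]

end

/-! Divide the numerator and denominator of Bayes' formula by the likelihood at `θs`. It suffices
that, for some `κ > 1`, the prior integral of the likelihood ratio away from `θs` is almost surely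
`o(κ⁻ⁿ)`, while over the whole parameter space it is eventually at least `c κ⁻ⁿ` with `c > 0`.

Numerator (`ExponentiallySmallOn.of_separated`): a bounded `g` whose mean under every `θ ∈ S`
exceeds its mean under `θs` by a fixed gap yields a Chernoff weight. By Tonelli the likelihood ratio
turns `θs`-expectations into `θ`-expectations, so no supremum over `S` is ever taken. For the cosine
model take `g` proportional to `f_θ₀ - f_θs`: its mean under `θ₀` minus its mean under `θs` is
`‖f_θ₀ - f_θs‖²` in `L²`, which is positive by identifiability. Continuity makes this work near each
`θ₀ ≠ θs`. As `θ → ∞`, `F_θ` tends weakly to the uniform law `F_0`, so `θ₀ = 0` handles a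
neighbourhood of infinity, because `θs ≠ 0`. Compactness does the rest.

Denominator (`ae_eventually_le_pow_mul_lintegral_likelihoodRatio`): the zeros of `f_θ` move with
`θ`, so `f_θs / f_θ` may be unbounded. Its moment of order `1/4` under `θs` nevertheless tends to
`1` as `θ → θs` (`tendsto_integral_inverseMomentIntegrand`): the substitution `z = θ y` fixes the
singularities and permits dominated convergence. Full support gives positive prior mass to the
neighbourhood where this moment is close to `1`. -/

/-! ### Almost sure decay from geometric bounds on expectations. -/

theorem ae_tendsto_zero_of_lintegral_le_pow {α : Type*} [MeasurableSpace α] {μ : Measure α}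
    {W : ℕ → α → ℝ≥0∞} (hW : ∀ n, Measurable (W n)) {r : ℝ≥0∞} (hr : r < 1)
    (h : ∀ n, ∫⁻ x, W n x ∂μ ≤ r ^ n) :
    ∀ᵐ x ∂μ, Tendsto (fun n => W n x) atTop (𝓝 0) := by
  -- The expectations are summable, so the series of the `W n` converges almost surely and its terms
  -- vanish in the limit.
  have hsum : ∫⁻ x, ∑' n, W n x ∂μ ≠ ∞ := by
    rw [lintegral_tsum fun n => (hW n).aemeasurable]
    refine ne_top_of_le_ne_top ?_ (ENNReal.tsum_le_tsum h)
    rw [ENNReal.tsum_geometric]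
    exact ENNReal.inv_ne_top.mpr (tsub_pos_of_lt hr).ne'
  filter_upwards [ae_lt_top (Measurable.tsum hW) hsum] with x hx
  exact ENNReal.tendsto_atTop_zero_of_tsum_ne_top hx.ne

theorem lintegral_prod_range_infinitePi {X : Type*} [MeasurableSpace X] (μ : Measure X)
    [IsProbabilityMeasure μ] {h : X → ℝ≥0∞} (hh : Measurable h) (n : ℕ) :
    ∫⁻ x, ∏ i ∈ Finset.range n, h (x i) ∂(Measure.infinitePi fun _ : ℕ => μ)
      = (∫⁻ y, h y ∂μ) ^ n := by
  have hind : ProbabilityTheory.iIndepFun (fun (i : ℕ) (x : ℕ → X) => h (x i))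
      (Measure.infinitePi fun _ : ℕ => μ) :=
    ProbabilityTheory.iIndepFun_infinitePi (X := fun _ => h) (fun _ => hh)
  induction n with
  | zero => simp
  | succ n ih =>
    have h2 := hind.indepFun_prod_range_succ (fun i => by fun_prop) n
    have h3 := ProbabilityTheory.lintegral_mul_eq_lintegral_mul_lintegral_of_indepFun
      (μ := Measure.infinitePi fun _ : ℕ => μ)
      (Finset.measurable_prod (Finset.range n) fun i _ => hh.comp (measurable_pi_apply i))
      (hh.comp (measurable_pi_apply n)) (by
        convert h2 using 1
        · ext x; simp
        · rfl)
    have h4 : ∫⁻ x, h (x n) ∂(Measure.infinitePi fun _ : ℕ => μ) = ∫⁻ y, h y ∂μ :=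
      (measurePreserving_eval_infinitePi (fun _ : ℕ => μ) n).lintegral_comp hh
    simp only [Function.comp_apply, Pi.mul_apply, h4] at h3
    rw [pow_succ, ← ih, ← h3]
    refine lintegral_congr fun x => ?_
    rw [Finset.prod_range_succ]

section Product

variable {Θ X : Type*} [MeasurableSpace Θ] [MeasurableSpace X]

theorem measurable_uncurry_prod_range {h : Θ → X → ℝ≥0∞} (hh : Measurable (Function.uncurry h))
    (n : ℕ) : Measurable fun p : (ℕ → X) × Θ => ∏ i ∈ Finset.range n, h p.2 (p.1 i) := by
  refine Finset.measurable_prod _ fun i _ => ?_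
  exact hh.comp (measurable_snd.prodMk ((measurable_pi_apply i).comp measurable_fst))

theorem measurable_lintegral_prod_range {h : Θ → X → ℝ≥0∞}
    (hh : Measurable (Function.uncurry h)) (π : Measure Θ) [SFinite π] (n : ℕ) :
    Measurable fun x : ℕ → X => ∫⁻ θ, ∏ i ∈ Finset.range n, h θ (x i) ∂π :=
  (measurable_uncurry_prod_range hh n).lintegral_prod_right'

/-- By Tonelli, independence is used for one fixed `θ` at a time; hence no uniformity over the
sample paths is needed. -/
theorem lintegral_lintegral_prod_range_le {h : Θ → X → ℝ≥0∞}
    (hh : Measurable (Function.uncurry h)) (π : Measure Θ) [SFinite π] (hπ : π Set.univ ≤ 1)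
    (μ : Measure X) [IsProbabilityMeasure μ] {r : ℝ≥0∞} (hr : ∀ᵐ θ ∂π, ∫⁻ y, h θ y ∂μ ≤ r)
    (n : ℕ) :
    ∫⁻ x, ∫⁻ θ, ∏ i ∈ Finset.range n, h θ (x i) ∂π ∂(Measure.infinitePi fun _ : ℕ => μ)
      ≤ r ^ n := by
  rw [lintegral_lintegral_swap (measurable_uncurry_prod_range hh n).aemeasurable]
  calc ∫⁻ θ, ∫⁻ x, ∏ i ∈ Finset.range n, h θ (x i) ∂(Measure.infinitePi fun _ : ℕ => μ) ∂π
      ≤ ∫⁻ _, r ^ n ∂π := by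
        refine lintegral_mono_ae ?_
        filter_upwards [hr] with θ hθ
        rw [lintegral_prod_range_infinitePi μ (h := h θ) (hh.comp measurable_prodMk_left)]
        gcongr
    _ ≤ r ^ n := by
        rw [lintegral_const]
        exact mul_le_of_le_one_right' hπ

theorem ae_tendsto_zero_lintegral_prod_range {h : Θ → X → ℝ≥0∞}
    (hh : Measurable (Function.uncurry h)) (π : Measure Θ) [SFinite π] (hπ : π Set.univ ≤ 1)
    (μ : Measure X) [IsProbabilityMeasure μ] {r : ℝ≥0∞} (hr1 : r < 1)
    (hr : ∀ᵐ θ ∂π, ∫⁻ y, h θ y ∂μ ≤ r) :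
    ∀ᵐ x ∂(Measure.infinitePi fun _ : ℕ => μ),
      Tendsto (fun n => ∫⁻ θ, ∏ i ∈ Finset.range n, h θ (x i) ∂π) atTop (𝓝 0) :=
  ae_tendsto_zero_of_lintegral_le_pow (measurable_lintegral_prod_range hh π) hr1
    (lintegral_lintegral_prod_range_le hh π hπ μ hr)

end Product

/-- A Chernoff bound for a function with values in `[-1, 1]`. -/
theorem lintegral_exp_mul_sub_le {X : Type*} [MeasurableSpace X] (ν : Measure X)
    [IsProbabilityMeasure ν] {g : X → ℝ} (hg : Measurable g) (hg1 : ∀ x, |g x| ≤ 1)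
    {t : ℝ} (ht0 : 0 ≤ t) (ht1 : t ≤ 1) (a : ℝ) :
    ∫⁻ x, ENNReal.ofReal (Real.exp (t * (a - g x))) ∂ν
      ≤ ENNReal.ofReal (Real.exp (t * (a - ∫ x, g x ∂ν) + t ^ 2)) := by
  have hint : Integrable g ν :=
    Integrable.of_bound hg.aestronglyMeasurable 1 (Eventually.of_forall hg1)
  have hb : ∀ x, Real.exp (t * (a - g x)) ≤ Real.exp (t * a) * (1 - t * g x + t ^ 2) := by
    intro x
    have h1 : |-(t * g x)| ≤ 1 := by
      rw [abs_neg, abs_mul, abs_of_nonneg ht0]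
      exact mul_le_one₀ ht1 (abs_nonneg _) (hg1 x)
    -- This is `exp u ≤ 1 + u + u²` for `|u| ≤ 1`, which is where `t ≤ 1` enters.
    have h2 := (abs_le.mp (Real.abs_exp_sub_one_sub_id_le h1)).2
    have h3 : (g x) ^ 2 ≤ 1 := (sq_le_one_iff_abs_le_one _).mpr (hg1 x)
    have h4 : t ^ 2 * (g x) ^ 2 ≤ t ^ 2 := mul_le_of_le_one_right (sq_nonneg t) h3
    rw [show t * (a - g x) = t * a + -(t * g x) by ring, Real.exp_add]
    gcongr
    nlinarith
  have hint2 : Integrable (fun x => Real.exp (t * a) * (1 - t * g x + t ^ 2)) ν :=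
    ((((integrable_const 1).sub (hint.const_mul t)).add (integrable_const _)).const_mul _)
  calc ∫⁻ x, ENNReal.ofReal (Real.exp (t * (a - g x))) ∂ν
      ≤ ∫⁻ x, ENNReal.ofReal (Real.exp (t * a) * (1 - t * g x + t ^ 2)) ∂ν :=
        lintegral_mono fun x => ENNReal.ofReal_le_ofReal (hb x)
    _ = ENNReal.ofReal (∫ x, Real.exp (t * a) * (1 - t * g x + t ^ 2) ∂ν) :=
        (ofReal_integral_eq_lintegral_ofReal hint2
          (Eventually.of_forall fun x => (Real.exp_pos _).le.trans (hb x))).symm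
    _ ≤ _ := by
        refine ENNReal.ofReal_le_ofReal ?_
        have hI : ∫ x, (1 - t * g x + t ^ 2) ∂ν = 1 - t * (∫ x, g x ∂ν) + t ^ 2 := by
          rw [integral_add (f := fun x => 1 - t * g x)
            ((integrable_const 1).sub (hint.const_mul t)) (integrable_const _),
            integral_sub (integrable_const 1) (hint.const_mul t), integral_const_mul]
          simp
        rw [integral_const_mul, hI]
        rw [show t * (a - ∫ x, g x ∂ν) + t ^ 2 = t * a + (t ^ 2 - t * ∫ x, g x ∂ν) by ring,
          Real.exp_add]
        gcongr
        linarith [Real.add_one_le_exp (t ^ 2 - t * ∫ x, g x ∂ν)]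

/-- Empirical means of a function with values in `[-1, 1]` are eventually below any number
exceeding its expectation. -/
theorem ae_eventually_sum_range_le {X : Type*} [MeasurableSpace X] (μ : Measure X)
    [IsProbabilityMeasure μ] {g : X → ℝ} (hg : Measurable g) (hg1 : ∀ x, |g x| ≤ 1)
    {δ : ℝ} (hδ0 : 0 < δ) (hδ1 : δ ≤ 1) :
    ∀ᵐ x ∂(Measure.infinitePi fun _ : ℕ => μ), ∀ᶠ n : ℕ in atTop,
      0 ≤ ∑ i ∈ Finset.range n, ((∫ y, g y ∂μ) + δ - g (x i)) := by
  set a := (∫ y, g y ∂μ) + δ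
  -- The minimiser of the Chernoff exponent `-t δ + t²`; the bound is applied to `-g` at level `-a`.
  set t := δ / 2 with ht
  have hexp := lintegral_exp_mul_sub_le μ hg.neg (fun x => by simpa using hg1 x)
    (show 0 ≤ t by positivity) (by linarith) (-a)
  have hr1 : ENNReal.ofReal (Real.exp (t * (-a - ∫ x, (-g) x ∂μ) + t ^ 2)) < 1 := by
    rw [← ENNReal.ofReal_one]
    refine (ENNReal.ofReal_lt_ofReal_iff one_pos).mpr (Real.exp_lt_one_iff.mpr ?_)
    simp only [Pi.neg_apply, integral_neg]
    simp only [a, ht]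
    nlinarith
  have hm : Measurable fun y => ENNReal.ofReal (Real.exp (t * (-a - (-g) y))) := by
    simp only [Pi.neg_apply]; fun_prop
  have h := ae_tendsto_zero_of_lintegral_le_pow (μ := Measure.infinitePi fun _ : ℕ => μ)
    (W := fun n x => ∏ i ∈ Finset.range n, ENNReal.ofReal (Real.exp (t * (-a - (-g) (x i)))))
    (fun n => Finset.measurable_prod _ fun i _ => hm.comp (measurable_pi_apply i)) hr1
    (fun n => by rw [lintegral_prod_range_infinitePi μ hm]; gcongr)
  filter_upwards [h] with x hx
  filter_upwards [hx.eventually (gt_mem_nhds zero_lt_one)] with n hn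
  rw [← ENNReal.ofReal_prod_of_nonneg (fun i _ => (Real.exp_pos _).le), ← Real.exp_sum,
    ← ENNReal.ofReal_one, ENNReal.ofReal_lt_ofReal_iff one_pos, Real.exp_lt_one_iff,
    ← Finset.mul_sum] at hn
  have ht0 : 0 < t := by positivity
  have := neg_of_mul_neg_right hn ht0.le
  have h5 : ∑ i ∈ Finset.range n, (a - g (x i)) =
      - ∑ i ∈ Finset.range n, (-a - (-g) (x i)) := by
    rw [← Finset.sum_neg_distrib]
    refine Finset.sum_congr rfl fun i _ => ?_
    simp only [Pi.neg_apply]; ring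
  rw [h5]; linarith

/-! ### Posterior consistency in a general dominated model. -/

section Bayes

variable {Θ : Type*}

/-- The likelihood ratio `∏ f_θ(x_i) / f_θs(x_i)` of the first `n` observations. -/
noncomputable def likelihoodRatio (f : Θ → ℝ → ℝ) (θs : Θ) (x : ℕ → ℝ) (n : ℕ) (θ : Θ) : ℝ≥0∞ :=
  ∏ i ∈ Finset.range n, ENNReal.ofReal (f θ (x i)) / ENNReal.ofReal (f θs (x i))

theorem likelihood_ne_zero {f : Θ → ℝ → ℝ} {θs : Θ} {x : ℕ → ℝ} (hx : ∀ i, 0 < f θs (x i))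
    (n : ℕ) : likelihood f x n θs ≠ 0 :=
  Finset.prod_ne_zero_iff.mpr fun i _ => (ENNReal.ofReal_pos.mpr (hx i)).ne'

theorem likelihood_ne_top (f : Θ → ℝ → ℝ) (θ : Θ) (x : ℕ → ℝ) (n : ℕ) :
    likelihood f x n θ ≠ ∞ :=
  ENNReal.prod_ne_top fun _ _ => ENNReal.ofReal_ne_top

theorem likelihood_eq_mul_likelihoodRatio {f : Θ → ℝ → ℝ} {θs : Θ} {x : ℕ → ℝ}
    (hx : ∀ i, 0 < f θs (x i)) (n : ℕ) (θ : Θ) :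
    likelihood f x n θ = likelihood f x n θs * likelihoodRatio f θs x n θ := by
  unfold likelihood likelihoodRatio
  rw [← Finset.prod_mul_distrib]
  refine Finset.prod_congr rfl fun i _ => ?_
  exact (ENNReal.mul_div_cancel (ENNReal.ofReal_pos.mpr (hx i)).ne' ENNReal.ofReal_ne_top).symm

variable [MeasurableSpace Θ]

theorem measurable_density {f : Θ → ℝ → ℝ} (hf : Measurable (Function.uncurry f)) (θ : Θ) :
    Measurable (f θ) :=
  hf.comp measurable_prodMk_left

theorem measurable_density_ratio {f : Θ → ℝ → ℝ} (hf : Measurable (Function.uncurry f)) (θs : Θ) :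
    Measurable (Function.uncurry fun θ y =>
      ENNReal.ofReal (f θ y) / ENNReal.ofReal (f θs y)) :=
  hf.ennreal_ofReal.div
    (((measurable_density hf θs).comp measurable_snd).ennreal_ofReal)

theorem measurable_likelihoodRatio {f : Θ → ℝ → ℝ} (hf : Measurable (Function.uncurry f))
    (θs : Θ) (x : ℕ → ℝ) (n : ℕ) : Measurable (likelihoodRatio f θs x n) :=
  Finset.measurable_prod _ fun _ _ => (measurable_density_ratio hf θs).comp measurable_prodMk_right

theorem ae_forall_density_pos {f : Θ → ℝ → ℝ} (hf : Measurable (Function.uncurry f)) (θs : Θ)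
    [IsProbabilityMeasure (modelMeasure f θs)] :
    ∀ᵐ x ∂(Measure.infinitePi fun _ : ℕ => modelMeasure f θs), ∀ i, 0 < f θs (x i) := by
  rw [ae_all_iff]
  intro i
  have h : ∀ᵐ y ∂(modelMeasure f θs), 0 < f θs y := by
    rw [modelMeasure, ae_withDensity_iff (measurable_density hf θs).ennreal_ofReal]
    refine Eventually.of_forall fun y hy => ?_
    exact ENNReal.ofReal_pos.mp (pos_iff_ne_zero.mpr hy)
  exact (measurePreserving_eval_infinitePi (fun _ : ℕ => modelMeasure f θs) i).quasiMeasurePreserving.ae h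

/-- Change of measure from `θs` to `θ`. Only an inequality holds, since the mass of `F_θ` on the
zero set of `f θs` is lost. -/
theorem lintegral_ratio_mul_le {f : Θ → ℝ → ℝ} (hf : Measurable (Function.uncurry f)) (θs θ : Θ)
    {e : ℝ → ℝ≥0∞} (he : Measurable e) :
    ∫⁻ y, ENNReal.ofReal (f θ y) / ENNReal.ofReal (f θs y) * e y ∂(modelMeasure f θs)
      ≤ ∫⁻ y, e y ∂(modelMeasure f θ) := by
  have h1 := (measurable_density hf θ).ennreal_ofReal
  have h2 := (measurable_density hf θs).ennreal_ofReal
  have h3 : Measurable fun y => ENNReal.ofReal (f θ y) / ENNReal.ofReal (f θs y) * e y :=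
    (h1.div h2).mul he
  rw [modelMeasure, modelMeasure, lintegral_withDensity_eq_lintegral_mul _ h2 h3,
    lintegral_withDensity_eq_lintegral_mul _ h1 he]
  refine lintegral_mono fun y => ?_
  simp only [Pi.mul_apply]
  rw [← mul_assoc]
  gcongr
  exact ENNReal.mul_div_le

/-- The prior mass of `S`, weighted with the likelihood ratio, decays exponentially fast, almost
surely under the distribution with parameter `θs`. -/
def ExponentiallySmallOn (f : Θ → ℝ → ℝ) (prior : Measure Θ) (θs : Θ)
    [IsProbabilityMeasure (modelMeasure f θs)] (S : Set Θ) : Prop :=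
  ∃ κ : ℝ≥0∞, 1 < κ ∧ κ ≠ ∞ ∧ ∀ᵐ x ∂(Measure.infinitePi fun _ : ℕ => modelMeasure f θs),
    Tendsto (fun n => κ ^ n * ∫⁻ θ in S, likelihoodRatio f θs x n θ ∂prior) atTop (𝓝 0)

namespace ExponentiallySmallOn

variable {f : Θ → ℝ → ℝ} {prior : Measure Θ} {θs : Θ} [IsProbabilityMeasure (modelMeasure f θs)]
  {S T : Set Θ}

theorem empty : ExponentiallySmallOn f prior θs ∅ :=
  ⟨2, by norm_num, by norm_num, by simp⟩

theorem mono (h : ExponentiallySmallOn f prior θs T) (hST : S ⊆ T) :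
    ExponentiallySmallOn f prior θs S := by
  obtain ⟨κ, h1, h2, h3⟩ := h
  refine ⟨κ, h1, h2, h3.mono fun x hx => ?_⟩
  refine tendsto_of_tendsto_of_tendsto_of_le_of_le tendsto_const_nhds hx (fun _ => zero_le) ?_
  intro n
  dsimp only
  gcongr

theorem union (hS : ExponentiallySmallOn f prior θs S) (hT : ExponentiallySmallOn f prior θs T) :
    ExponentiallySmallOn f prior θs (S ∪ T) := by
  obtain ⟨κ, h1, h2, h3⟩ := hS
  obtain ⟨κ', h1', h2', h3'⟩ := hT
  refine ⟨min κ κ', lt_min h1 h1', by simp [h2], ?_⟩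
  filter_upwards [h3, h3'] with x hx hx'
  have hsum := hx.add hx'
  rw [add_zero] at hsum
  refine tendsto_of_tendsto_of_tendsto_of_le_of_le tendsto_const_nhds hsum (fun _ => zero_le) ?_
  intro n
  dsimp only
  calc min κ κ' ^ n * ∫⁻ θ in S ∪ T, likelihoodRatio f θs x n θ ∂prior
      ≤ min κ κ' ^ n * ((∫⁻ θ in S, likelihoodRatio f θs x n θ ∂prior)
          + ∫⁻ θ in T, likelihoodRatio f θs x n θ ∂prior) := by
        gcongr; exact lintegral_union_le _ _ _
    _ ≤ _ := by
        rw [mul_add]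
        gcongr
        · exact min_le_left _ _
        · exact min_le_right _ _

end ExponentiallySmallOn

/-- A set of parameters that a bounded function separates uniformly from `θs`. -/
theorem ExponentiallySmallOn.of_separated {f : Θ → ℝ → ℝ} {prior : Measure Θ}
    [IsProbabilityMeasure prior] {θs : Θ} {S : Set Θ} [∀ θ, IsProbabilityMeasure (modelMeasure f θ)] (hf : Measurable (Function.uncurry f))
    (hS : MeasurableSet S) {g : ℝ → ℝ} (hg : Measurable g) (hg1 : ∀ y, |g y| ≤ 1)
    {δ : ℝ} (hδ0 : 0 < δ) (hδ1 : δ ≤ 1)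
    (h : ∀ θ ∈ S, (∫ y, g y ∂(modelMeasure f θs)) + 2 * δ ≤ ∫ y, g y ∂(modelMeasure f θ)) :
    ExponentiallySmallOn f prior θs S := by
  set a := (∫ y, g y ∂(modelMeasure f θs)) + δ
  set t := δ / 2 with ht
  -- On `S` one has `a - E_θ g ≤ -δ`, so the Chernoff exponent is at most `-δ²/4`. Half of it is
  -- spent on `κ`, the other half keeps the rate below `1`.
  set κ := ENNReal.ofReal (Real.exp (δ ^ 2 / 8)) with hκ
  set e : ℝ → ℝ≥0∞ := fun y => ENNReal.ofReal (Real.exp (t * (a - g y))) with he_def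
  have he : Measurable e := by fun_prop
  set H : Θ → ℝ → ℝ≥0∞ := fun θ y =>
    κ * (ENNReal.ofReal (f θ y) / ENNReal.ofReal (f θs y) * e y) with hH_def
  have hH : Measurable (Function.uncurry H) :=
    ((measurable_density_ratio hf θs).mul (he.comp measurable_snd)).const_mul κ
  have hr : ∀ θ ∈ S, ∫⁻ y, H θ y ∂(modelMeasure f θs)
      ≤ ENNReal.ofReal (Real.exp (-(δ ^ 2 / 8))) := by
    intro θ hθ
    have hm : Measurable fun y =>
        ENNReal.ofReal (f θ y) / ENNReal.ofReal (f θs y) * e y :=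
      ((measurable_density_ratio hf θs).comp measurable_prodMk_left).mul he
    rw [lintegral_const_mul _ hm]
    calc _ ≤ κ * ENNReal.ofReal (Real.exp
          (t * (a - ∫ y, g y ∂(modelMeasure f θ)) + t ^ 2)) := by
          gcongr
          exact (lintegral_ratio_mul_le hf θs θ he).trans
            (lintegral_exp_mul_sub_le _ hg hg1 (by positivity) (by linarith) a)
      _ ≤ _ := by
          rw [hκ, ← ENNReal.ofReal_mul (Real.exp_pos _).le, ← Real.exp_add]
          refine ENNReal.ofReal_le_ofReal (Real.exp_le_exp.mpr ?_)
          have := h θ hθ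
          simp only [ht, a]
          nlinarith
  have hmain := ae_tendsto_zero_lintegral_prod_range hH (prior.restrict S)
    (by simpa using prob_le_one) (modelMeasure f θs)
    (r := ENNReal.ofReal (Real.exp (-(δ ^ 2 / 8)))) (by
      rw [← ENNReal.ofReal_one, ENNReal.ofReal_lt_ofReal_iff one_pos, Real.exp_lt_one_iff]
      have := sq_pos_of_pos hδ0
      linarith) (ae_restrict_of_forall_mem hS hr)
  refine ⟨κ, ?_, ENNReal.ofReal_ne_top, ?_⟩
  · rw [hκ, ← ENNReal.ofReal_one, ENNReal.ofReal_lt_ofReal_iff (Real.exp_pos _), Real.one_lt_exp_iff]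
    positivity
  filter_upwards [hmain, ae_eventually_sum_range_le (modelMeasure f θs) hg hg1 hδ0 hδ1]
    with x hx hx2
  refine tendsto_of_tendsto_of_tendsto_of_le_of_le' tendsto_const_nhds hx
    (Eventually.of_forall fun _ => zero_le) ?_
  filter_upwards [hx2] with n hn
  -- The Chernoff weight is free of `θ` and eventually at least `1` under `θs`, so inserting it can
  -- only increase the integral.
  have hE : 1 ≤ ∏ i ∈ Finset.range n, e (x i) := by
    rw [he_def, ← ENNReal.ofReal_prod_of_nonneg (fun i _ => (Real.exp_pos _).le), ← Real.exp_sum,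
      ← Finset.mul_sum]
    rw [← ENNReal.ofReal_one]
    refine ENNReal.ofReal_le_ofReal (Real.one_le_exp (mul_nonneg (by positivity) hn))
  rw [← lintegral_const_mul _ (measurable_likelihoodRatio hf θs x n)]
  refine lintegral_mono fun θ => ?_
  simp only [hH_def, Finset.prod_mul_distrib, Finset.prod_const, Finset.card_range,
    likelihoodRatio]
  gcongr
  exact le_mul_of_one_le_right' hE

/-- Either the product or the power of its inverse is at least `1`. Finiteness of the factors
excludes `0 * ∞`, so that inversion commutes with the product. -/
theorem one_le_prod_add_prod_inv_rpow {ι : Type*} (I : Finset ι) {y : ι → ℝ≥0∞}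
    (hy : ∀ i ∈ I, y i ≠ ∞) {s : ℝ} (hs : 0 < s) :
    1 ≤ ∏ i ∈ I, y i + ∏ i ∈ I, ((y i)⁻¹) ^ s := by
  rw [ENNReal.prod_rpow_of_nonneg hs.le, ← ENNReal.prod_inv_distrib
    (fun i _ j hj _ => Or.inr (hy j hj))]
  rcases le_total 1 (∏ i ∈ I, y i) with h | h
  · exact h.trans le_self_add
  · exact (ENNReal.one_le_rpow (ENNReal.one_le_inv.mpr h) hs).trans le_add_self

/-- A lower bound for the normalizing constant from a fractional inverse moment of the
likelihood ratio. -/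
theorem ae_eventually_le_pow_mul_lintegral_likelihoodRatio {f : Θ → ℝ → ℝ}
    (hf : Measurable (Function.uncurry f)) (prior : Measure Θ) [IsProbabilityMeasure prior]
    (θs : Θ) [IsProbabilityMeasure (modelMeasure f θs)] {S : Set Θ} (hS : MeasurableSet S)
    (hS0 : prior S ≠ 0) {k : ℝ≥0∞} (hk : k ≠ ∞) {s : ℝ} (hs : 0 < s) {r : ℝ≥0∞} (hr : r < 1)
    (h : ∀ θ ∈ S, ∫⁻ y, ((k * (ENNReal.ofReal (f θ y) / ENNReal.ofReal (f θs y)))⁻¹) ^ s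
      ∂(modelMeasure f θs) ≤ r) :
    ∀ᵐ x ∂(Measure.infinitePi fun _ : ℕ => modelMeasure f θs), ∀ᶠ n : ℕ in atTop,
      prior S / 2 ≤ k ^ n * ∫⁻ θ, likelihoodRatio f θs x n θ ∂prior := by
  have hm := ((measurable_density_ratio hf θs).const_mul k).inv.pow_const s
  have hmain := ae_tendsto_zero_lintegral_prod_range (h := fun θ y =>
    ((k * (ENNReal.ofReal (f θ y) / ENNReal.ofReal (f θs y)))⁻¹) ^ s) hm (prior.restrict S)
    (by simpa using prob_le_one) (modelMeasure f θs) hr (ae_restrict_of_forall_mem hS h)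
  filter_upwards [hmain, ae_forall_density_pos hf θs] with x hx hpos
  have hS2 : 0 < prior S / 2 := ENNReal.half_pos hS0
  filter_upwards [hx.eventually (gt_mem_nhds hS2)] with n hn
  -- The integral over `S` of the inverse power tends to `0`; once it is below half of `prior S`,
  -- the other term must supply the remaining half.
  have h1 : prior S ≤ k ^ n * (∫⁻ θ, likelihoodRatio f θs x n θ ∂prior) + prior S / 2 := by
    calc prior S = ∫⁻ _ in S, 1 ∂prior := by simp
      _ ≤ ∫⁻ θ in S, (k ^ n * likelihoodRatio f θs x n θ + ∏ i ∈ Finset.range n,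
          ((k * (ENNReal.ofReal (f θ (x i)) / ENNReal.ofReal (f θs (x i))))⁻¹) ^ s) ∂prior := by
          refine lintegral_mono fun θ => ?_
          convert one_le_prod_add_prod_inv_rpow (Finset.range n) (y := fun i =>
            k * (ENNReal.ofReal (f θ (x i)) / ENNReal.ofReal (f θs (x i)))) ?_ hs using 2
          · simp only [Finset.prod_mul_distrib, Finset.prod_const, Finset.card_range,
              likelihoodRatio]
          · exact fun i _ => ENNReal.mul_ne_top hk (ENNReal.div_ne_top ENNReal.ofReal_ne_top
              (ENNReal.ofReal_pos.mpr (hpos i)).ne')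
      _ ≤ _ := by
          rw [lintegral_add_left ((measurable_likelihoodRatio hf θs x n).const_mul _),
            lintegral_const_mul _ (measurable_likelihoodRatio hf θs x n)]
          exact add_le_add (mul_le_mul' le_rfl (setLIntegral_le_lintegral _ _)) hn.le
  have hfin : prior S / 2 ≠ ∞ := ENNReal.div_ne_top (measure_ne_top _ _) two_ne_zero
  exact (ENNReal.add_le_add_iff_right hfin).mp ((ENNReal.add_halves (prior S)).le.trans h1)

/-- The normalizing constant is almost surely finite because the likelihood ratio has expectation at
most `1` for each `θ`. -/
theorem ae_isProbabilityMeasure_bayesPosterior {f : Θ → ℝ → ℝ}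
    (hf : Measurable (Function.uncurry f)) (prior : Measure Θ) [IsProbabilityMeasure prior]
    (θs : Θ) [∀ θ, IsProbabilityMeasure (modelMeasure f θ)]
    (hpos : ∀ x : ℕ → ℝ, (∀ i, 0 < f θs (x i)) → ∀ n, ∫⁻ θ, likelihood f x n θ ∂prior ≠ 0) :
    ∀ᵐ x ∂(Measure.infinitePi fun _ : ℕ => modelMeasure f θs),
      ∀ n : ℕ, IsProbabilityMeasure (bayesPosterior f prior x n) := by
  have hfin : ∀ᵐ x ∂(Measure.infinitePi fun _ : ℕ => modelMeasure f θs), ∀ n,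
      ∫⁻ θ, likelihoodRatio f θs x n θ ∂prior < ∞ := by
    rw [ae_all_iff]
    intro n
    have hm := measurable_density_ratio hf θs
    refine ae_lt_top (measurable_lintegral_prod_range hm prior n) (ne_top_of_le_ne_top ?_
      (lintegral_lintegral_prod_range_le hm prior prob_le_one (modelMeasure f θs) (r := 1)
        (Eventually.of_forall fun θ => ?_) n))
    · simp
    · simpa using lintegral_ratio_mul_le hf θs θ (measurable_const (a := (1 : ℝ≥0∞)))
  filter_upwards [hfin, ae_forall_density_pos hf θs] with x hx hx0 n
  constructor
  rw [bayesPosterior, Measure.smul_apply, withDensity_apply _ MeasurableSet.univ,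
    Measure.restrict_univ, smul_eq_mul]
  refine ENNReal.inv_mul_cancel (hpos x hx0 n) ?_
  rw [lintegral_congr (likelihood_eq_mul_likelihoodRatio hx0 n), lintegral_const_mul _ (measurable_likelihoodRatio hf θs x n)]
  exact ENNReal.mul_ne_top (likelihood_ne_top f θs x n) (hx n).ne

theorem bayesPosterior_apply_eq_ratio {f : Θ → ℝ → ℝ} (hf : Measurable (Function.uncurry f))
    (prior : Measure Θ) {θs : Θ} {x : ℕ → ℝ} (hx : ∀ i, 0 < f θs (x i)) (n : ℕ) {B : Set Θ}
    (hB : MeasurableSet B) :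
    bayesPosterior f prior x n B = (∫⁻ θ, likelihoodRatio f θs x n θ ∂prior)⁻¹ *
      ∫⁻ θ in B, likelihoodRatio f θs x n θ ∂prior := by
  have h0 := likelihood_ne_zero hx n
  have ht := likelihood_ne_top f θs x n
  have hm := measurable_likelihoodRatio hf θs x n
  rw [bayesPosterior, Measure.smul_apply, withDensity_apply _ hB, smul_eq_mul]
  rw [lintegral_congr (likelihood_eq_mul_likelihoodRatio hx n),
    lintegral_congr (likelihood_eq_mul_likelihoodRatio hx n), lintegral_const_mul _ hm, lintegral_const_mul _ hm,
    ENNReal.mul_inv (Or.inl h0) (Or.inl ht), mul_mul_mul_comm, ENNReal.inv_mul_cancel h0 ht,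
    one_mul]

/-- Posterior consistency from exponential decay away from `θs` and fractional inverse moments of
the likelihood ratio close to one near `θs`. -/
theorem posteriorConsistentAt_of_exponentiallySmallOn [PseudoMetricSpace Θ]
    [OpensMeasurableSpace Θ] {f : Θ → ℝ → ℝ} (hf : Measurable (Function.uncurry f))
    (prior : Measure Θ) [IsProbabilityMeasure prior] (θs : Θ)
    [IsProbabilityMeasure (modelMeasure f θs)] {s : ℝ} (hs : 0 < s)
    (hfar : ∀ ε : ℝ, 0 < ε → ExponentiallySmallOn f prior θs {θ | dist θ θs < ε}ᶜ)
    (hnear : ∀ k : ℝ≥0∞, 1 < k → k ≠ ∞ → ∃ S, MeasurableSet S ∧ prior S ≠ 0 ∧ ∃ r < 1,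
      ∀ θ ∈ S, ∫⁻ y, ((k * (ENNReal.ofReal (f θ y) / ENNReal.ofReal (f θs y)))⁻¹) ^ s
        ∂(modelMeasure f θs) ≤ r) :
    PosteriorConsistentAt f prior θs := by
  intro ε hε
  obtain ⟨κ, hκ1, hκt, hκ⟩ := hfar ε hε
  -- The rate `κ` of the numerator is reused for the denominator, so that `κ ^ n` cancels in the
  -- quotient.
  obtain ⟨S, hS, hS0, r, hr, h⟩ := hnear κ hκ1 hκt
  have hB : MeasurableSet {θ | dist θ θs < ε}ᶜ := (Metric.isOpen_ball (x := θs)).measurableSet.compl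
  filter_upwards [hκ, ae_forall_density_pos hf θs,
    ae_eventually_le_pow_mul_lintegral_likelihoodRatio hf prior θs hS hS0 hκt hs hr h]
    with x hx hpos hx2
  have hc : (prior S / 2)⁻¹ ≠ ∞ := ENNReal.inv_ne_top.mpr (ENNReal.half_pos hS0).ne'
  have hlim := ENNReal.Tendsto.const_mul hx (Or.inr hc)
  rw [mul_zero] at hlim
  refine tendsto_of_tendsto_of_tendsto_of_le_of_le' tendsto_const_nhds hlim
    (Eventually.of_forall fun _ => zero_le) ?_
  filter_upwards [hx2] with n hn
  have hκn0 : κ ^ n ≠ 0 := pow_ne_zero _ (zero_lt_one.trans hκ1).ne'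
  have hκnt : κ ^ n ≠ ∞ := ENNReal.pow_ne_top hκt
  rw [bayesPosterior_apply_eq_ratio hf prior hpos n hB, ← mul_assoc]
  gcongr
  calc (∫⁻ θ, likelihoodRatio f θs x n θ ∂prior)⁻¹
      = (κ ^ n * ∫⁻ θ, likelihoodRatio f θs x n θ ∂prior)⁻¹ * κ ^ n := by
        rw [ENNReal.mul_inv (Or.inl hκn0) (Or.inl hκnt), mul_right_comm,
          ENNReal.inv_mul_cancel hκn0 hκnt, one_mul]
    _ ≤ _ := by gcongr

end Bayes

/-! ### The inverse moment of order `1/4` and its continuity. -/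

/-- The zeros of `1 - cos` are quadratic: `1 - cos z ≥ (2/π²) z²` on `[-π, π]`, so the power `-1/4`
has at worst a `|z|^(-1/2)` singularity. Evenness and periodicity extend this to every interval. -/
theorem intervalIntegrable_one_sub_cos_rpow (a b : ℝ) :
    IntervalIntegrable (fun z => (1 - Real.cos z) ^ (-(1 / 4) : ℝ)) volume a b := by
  set f : ℝ → ℝ := fun z => (1 - Real.cos z) ^ (-(1 / 4) : ℝ) with hf
  have hfm : Measurable f := by fun_prop
  have h0 : IntervalIntegrable f volume 0 Real.pi := by
    have hg : IntervalIntegrable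
        (fun z : ℝ => (2 / Real.pi ^ 2) ^ (-(1 / 4) : ℝ) * z ^ (-(1 / 2) : ℝ)) volume 0 Real.pi :=
      (intervalIntegral.intervalIntegrable_rpow' (by norm_num)).const_mul _
    refine hg.mono_fun hfm.aestronglyMeasurable ?_
    rw [Set.uIoc_of_le Real.pi_pos.le]
    refine ae_restrict_of_forall_mem measurableSet_Ioc fun z hz => ?_
    have hπ := Real.pi_pos
    have hz0 := hz.1
    have h1 := Real.cos_le_one_sub_mul_cos_sq (x := z) (abs_le.mpr ⟨by linarith, hz.2⟩)
    have h2 : 0 < 2 / Real.pi ^ 2 * z ^ 2 := by positivity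
    dsimp only
    rw [Real.norm_of_nonneg (Real.rpow_nonneg (by linarith) _ : 0 ≤ f z),
      Real.norm_of_nonneg (by positivity)]
    calc f z ≤ (2 / Real.pi ^ 2 * z ^ 2) ^ (-(1 / 4) : ℝ) :=
          Real.rpow_le_rpow_of_nonpos h2 (by linarith) (by norm_num)
      _ = _ := by
          rw [Real.mul_rpow (by positivity) (by positivity), ← Real.rpow_natCast_mul hz0.le]
          norm_num
  have h1 : IntervalIntegrable f volume (-Real.pi) 0 := by
    have := (IntervalIntegrable.iff_comp_neg (f := f)).mp h0
    simp only [neg_zero] at this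
    refine this.symm.congr ?_
    exact fun z _ => by simp [hf]
  have hper : Function.Periodic f (2 * Real.pi) := fun z => by simp [hf]
  refine hper.intervalIntegrable (by positivity) (t := -Real.pi) ?_ a b
  rw [show -Real.pi + 2 * Real.pi = Real.pi by ring]
  exact h1.trans h0

theorem intervalIntegrable_one_add_cos_rpow (a b : ℝ) :
    IntervalIntegrable (fun z => (1 + Real.cos z) ^ (-(1 / 4) : ℝ)) volume a b := by
  have h := (intervalIntegrable_one_sub_cos_rpow (a + Real.pi) (b + Real.pi)).comp_add_right
    Real.pi
  simpa [Real.cos_add_pi] using h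

theorem ae_one_add_cos_mul_pos {t : ℝ} (ht : t ≠ 0) :
    ∀ᵐ y : ℝ, 0 < 1 + Real.cos (t * y) := by
  have hc : (Set.range fun k : ℤ => (Real.pi + k * (2 * Real.pi)) / t).Countable :=
    Set.countable_range _
  filter_upwards [hc.ae_notMem volume] with y hy
  have h1 := Real.neg_one_le_cos (t * y)
  refine lt_of_le_of_ne (by linarith) fun h => hy ?_
  obtain ⟨k, hk⟩ := Real.cos_eq_neg_one_iff.mp (show Real.cos (t * y) = -1 by linarith)
  exact ⟨k, by simp only [hk]; field_simp⟩

/-- The integrand of the moment of order `-1/4` of the likelihood ratio of the parameter `τ` to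
the parameter `t`, as a function of `z = τ y`. -/
noncomputable def inverseMomentIntegrand (t τ z : ℝ) : ℝ :=
  (1 + Real.cos (t * (z / τ))) / (1 + Real.sinc t) *
    ((1 + Real.cos (t * (z / τ))) / (1 + Real.sinc t) * (1 + Real.sinc τ)) ^ (1 / 4 : ℝ) *
    (1 + Real.cos z) ^ (-(1 / 4) : ℝ)

theorem measurable_inverseMomentIntegrand (t τ : ℝ) :
    Measurable (inverseMomentIntegrand t τ) := by
  unfold inverseMomentIntegrand
  fun_prop

theorem one_add_cos_nonneg (z : ℝ) : 0 ≤ 1 + Real.cos z := by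
  linarith [Real.neg_one_le_cos z]

theorem inverseMomentIntegrand_nonneg (t τ z : ℝ) : 0 ≤ inverseMomentIntegrand t τ z := by
  have h1 := one_add_sinc_pos t
  have h2 := one_add_sinc_pos τ
  have h3 := one_add_cos_nonneg (t * (z / τ))
  have h4 := one_add_cos_nonneg z
  unfold inverseMomentIntegrand
  positivity

theorem inverseMomentIntegrand_le (t τ z : ℝ) :
    ‖inverseMomentIntegrand t τ z‖ ≤ 2 / (1 + Real.sinc t) *
      (2 / (1 + Real.sinc t) * 2) ^ (1 / 4 : ℝ) * (1 + Real.cos z) ^ (-(1 / 4) : ℝ) := by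
  rw [Real.norm_of_nonneg (inverseMomentIntegrand_nonneg t τ z)]
  have h1 := one_add_sinc_pos t
  have h2 := one_add_sinc_pos τ
  have h3 := one_add_cos_nonneg (t * (z / τ))
  have h4 := one_add_cos_nonneg z
  have h5 : 1 + Real.cos (t * (z / τ)) ≤ 2 := by linarith [Real.cos_le_one (t * (z / τ))]
  have h6 : 1 + Real.sinc τ ≤ 2 := by linarith [Real.sinc_le_one τ]
  unfold inverseMomentIntegrand
  gcongr

theorem intervalIntegrable_inverseMomentIntegrand (t τ a b : ℝ) :
    IntervalIntegrable (inverseMomentIntegrand t τ) volume a b :=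
  ((intervalIntegrable_one_add_cos_rpow a b).const_mul _).mono_fun'
    (measurable_inverseMomentIntegrand t τ).aestronglyMeasurable
    (Eventually.of_forall (inverseMomentIntegrand_le t τ))

/-- In the variable `z` the singular factor does not depend on `τ`, and `inverseMomentIntegrand_le`
is a majorant valid for all `τ`. -/
theorem continuousAt_integral_inverseMomentIntegrand {t : ℝ} (ht : 0 < t) :
    ContinuousAt (fun τ => ∫ z in (0 : ℝ)..τ, inverseMomentIntegrand t τ z) t := by
  have h := intervalIntegral.continuousAt_parametric_primitive_of_dominated (μ := volume)
    (F := inverseMomentIntegrand t) (a₀ := 0) (b₀ := t) (x₀ := t) _ (-1) (t + 1)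
    (fun τ => (measurable_inverseMomentIntegrand t τ).aestronglyMeasurable)
    (Eventually.of_forall fun τ => Eventually.of_forall (inverseMomentIntegrand_le t τ))
    ((intervalIntegrable_one_add_cos_rpow _ _).const_mul _) (by
      refine Eventually.of_forall fun z => ?_
      unfold inverseMomentIntegrand
      have hc := Real.continuous_sinc
      have hd : ContinuousAt (fun τ : ℝ => z / τ) t :=
        continuousAt_const.div continuousAt_id ht.ne'
      refine ContinuousAt.mul (ContinuousAt.mul ?_ ?_) continuousAt_const
      · fun_prop
      · refine ContinuousAt.rpow_const ?_ (Or.inr (by norm_num))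
        fun_prop) (by constructor <;> linarith) (by constructor <;> linarith) (by simp)
  -- Joint continuity in parameter and endpoint, restricted to the diagonal.
  exact h.comp (f := fun τ : ℝ => (τ, τ)) (by fun_prop)

theorem integral_inverseMomentIntegrand_mul {t τ : ℝ} (hτ : τ ≠ 0) :
    ∫ y in (0 : ℝ)..1, inverseMomentIntegrand t τ (τ * y) =
      τ⁻¹ * ∫ z in (0 : ℝ)..τ, inverseMomentIntegrand t τ z := by
  rw [intervalIntegral.integral_comp_mul_left _ hτ]
  simp

theorem tendsto_integral_inverseMomentIntegrand {t : ℝ} (ht : 0 < t) :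
    Tendsto (fun τ => ∫ y in (0 : ℝ)..1, inverseMomentIntegrand t τ (τ * y)) (𝓝 t) (𝓝 1) := by
  have h1 : ∫ y in (0 : ℝ)..1, inverseMomentIntegrand t t (t * y) = 1 := by
    have h2 : ∫ y in (0 : ℝ)..1, inverseMomentIntegrand t t (t * y) =
        ∫ y in (0 : ℝ)..1, (1 + Real.cos (t * y)) / (1 + Real.sinc t) := by
      -- At `τ = t` the powers `1/4` and `-1/4` cancel off the null set of zeros, which leaves the
      -- density itself.
      refine intervalIntegral.integral_congr_ae ?_
      filter_upwards [ae_one_add_cos_mul_pos ht.ne'] with y hy _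
      have hc := one_add_sinc_pos t
      unfold inverseMomentIntegrand
      rw [mul_div_cancel_left₀ _ ht.ne', div_mul_cancel₀ _ hc.ne', mul_assoc,
        ← Real.rpow_add hy]
      norm_num
    rw [h2, intervalIntegral.integral_div, integral_one_add_cos_mul,
      div_self (one_add_sinc_pos t).ne']
  have hc : ContinuousAt (fun τ => τ⁻¹ * ∫ z in (0 : ℝ)..τ, inverseMomentIntegrand t τ z) t :=
    (continuousAt_inv₀ ht.ne').mul (continuousAt_integral_inverseMomentIntegrand ht)
  have hlim := hc.tendsto
  rw [← integral_inverseMomentIntegrand_mul ht.ne', h1] at hlim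
  refine hlim.congr' ?_
  filter_upwards [lt_mem_nhds ht] with τ hτ
  exact (integral_inverseMomentIntegrand_mul hτ.ne').symm

/-! ### Inverse moments of the likelihood ratio in the cosine model. -/

theorem measurable_cosineDensity : Measurable (Function.uncurry cosineDensity) := by
  have h : Function.uncurry cosineDensity = (Set.univ ×ˢ Set.Icc (0 : ℝ) 1).indicator
      fun p : ℝ≥0 × ℝ => (1 + Real.cos ((p.1 : ℝ) * p.2)) / (1 + Real.sinc (p.1 : ℝ)) := by
    ext ⟨θ, x⟩
    by_cases hx : x ∈ Set.Icc (0 : ℝ) 1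
    · rw [Set.indicator_of_mem (Set.mk_mem_prod (Set.mem_univ θ) hx)]
      simp only [Function.uncurry, cosineDensity, Set.indicator_of_mem hx]
    · rw [Set.indicator_of_notMem (fun h => hx h.2)]
      simp only [Function.uncurry, cosineDensity, Set.indicator_of_notMem hx]
  rw [h]
  have := Real.continuous_sinc.measurable
  refine Measurable.indicator ?_ (MeasurableSet.univ.prod measurableSet_Icc)
  fun_prop

theorem cosineDensity_of_mem (θ : ℝ≥0) {x : ℝ} (hx : x ∈ Set.Icc (0 : ℝ) 1) :
    cosineDensity θ x = (1 + Real.cos ((θ : ℝ) * x)) / (1 + Real.sinc (θ : ℝ)) := by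
  rw [cosineDensity, Set.indicator_of_mem hx]

theorem cosineDensity_of_notMem (θ : ℝ≥0) {x : ℝ} (hx : x ∉ Set.Icc (0 : ℝ) 1) :
    cosineDensity θ x = 0 := by
  rw [cosineDensity, Set.indicator_of_notMem hx]

theorem cosineDensity_nonneg (θ : ℝ≥0) (x : ℝ) : 0 ≤ cosineDensity θ x :=
  Set.indicator_nonneg
    (fun _ _ => div_nonneg (one_add_cos_nonneg _) (one_add_sinc_pos _).le) x

theorem lintegral_inverse_ratio_cosineDensity {θs θ : ℝ≥0} (hθs : 0 < θs) (hθ : 0 < θ) :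
    ∫⁻ y, ((ENNReal.ofReal (cosineDensity θ y) / ENNReal.ofReal (cosineDensity θs y))⁻¹) ^ (1 / 4 : ℝ)
      ∂(modelMeasure cosineDensity θs) =
    ENNReal.ofReal (∫ y in (0 : ℝ)..1, inverseMomentIntegrand θs θ (θ * y)) := by
  have hθ' : (0 : ℝ) < θ := hθ
  have hθs' : (0 : ℝ) < θs := hθs
  have hm := measurable_cosineDensity
  have h1 : ∀ τ, Measurable fun y => ENNReal.ofReal (cosineDensity τ y) :=
    fun τ => (measurable_density hm τ).ennreal_ofReal
  have h2 : Measurable fun y => ((ENNReal.ofReal (cosineDensity θ y) /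
      ENNReal.ofReal (cosineDensity θs y))⁻¹) ^ (1 / 4 : ℝ) :=
    (((h1 θ).div (h1 θs)).inv).pow_const _
  have hI : IntervalIntegrable (fun y => inverseMomentIntegrand θs θ (θ * y)) volume 0 1 := by
    have h := (intervalIntegrable_inverseMomentIntegrand θs θ 0 θ).comp_mul_left (c := (θ : ℝ))
    simpa [hθ'.ne'] using h
  rw [modelMeasure, lintegral_withDensity_eq_lintegral_mul _ (h1 θs) h2,
    intervalIntegral.integral_of_le zero_le_one, ofReal_integral_eq_lintegral_ofReal hI.1
      (Eventually.of_forall fun y => inverseMomentIntegrand_nonneg _ _ _),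
    Measure.restrict_congr_set Ioc_ae_eq_Icc, ← lintegral_indicator measurableSet_Icc]
  refine lintegral_congr_ae ?_
  filter_upwards [ae_one_add_cos_mul_pos hθ'.ne', ae_one_add_cos_mul_pos hθs'.ne'] with y hy hys
  by_cases hx : y ∈ Set.Icc (0 : ℝ) 1
  · have hc := one_add_sinc_pos (θ : ℝ)
    have hcs := one_add_sinc_pos (θs : ℝ)
    have hd := div_pos hy hc
    have hds := div_pos hys hcs
    simp only [Pi.mul_apply, Set.indicator_of_mem hx, cosineDensity_of_mem _ hx]
    rw [ENNReal.inv_div (Or.inl ENNReal.ofReal_ne_top) (Or.inl (ENNReal.ofReal_pos.mpr hds).ne'),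
      ← ENNReal.ofReal_div_of_pos hd, ENNReal.ofReal_rpow_of_pos (div_pos hds hd),
      ← ENNReal.ofReal_mul hds.le]
    congr 1
    unfold inverseMomentIntegrand
    rw [mul_div_cancel_left₀ _ hθ'.ne', mul_assoc]
    congr 1
    rw [Real.rpow_neg hy.le, ← div_eq_mul_inv, ← Real.div_rpow (by positivity) hy.le]
    congr 1
    field_simp
  · simp [Set.indicator_of_notMem hx, cosineDensity_of_notMem _ hx]

theorem exists_inverse_moment_cosineDensity_le (prior : Measure ℝ≥0)
    (hfull : ∀ U : Set ℝ≥0, IsOpen U → U.Nonempty → 0 < prior U) {θs : ℝ≥0} (hθs : 0 < θs)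
    {k : ℝ≥0∞} (hk : 1 < k) (hkt : k ≠ ∞) :
    ∃ S, MeasurableSet S ∧ prior S ≠ 0 ∧ ∃ r < 1, ∀ θ ∈ S,
      ∫⁻ y, ((k * (ENNReal.ofReal (cosineDensity θ y) /
        ENNReal.ofReal (cosineDensity θs y)))⁻¹) ^ (1 / 4 : ℝ)
        ∂(modelMeasure cosineDensity θs) ≤ r := by
  have hkq : (1 : ℝ≥0∞) < k ^ (1 / 4 : ℝ) := ENNReal.one_lt_rpow hk (by norm_num)
  have hkqt : k ^ (1 / 4 : ℝ) ≠ ∞ := ENNReal.rpow_ne_top_of_nonneg (by norm_num) hkt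
  -- Near `θs` the moment stays below `m`, and the factor `k` contributes `k ^ (-1/4)`; hence the
  -- rate is `m / k ^ (1/4) < 1`.
  obtain ⟨m, hm1, hmk⟩ := exists_between hkq
  have hlim : Tendsto (fun θ : ℝ≥0 =>
      ENNReal.ofReal (∫ y in (0 : ℝ)..1, inverseMomentIntegrand θs θ (θ * y))) (𝓝 θs) (𝓝 1) := by
    rw [← ENNReal.ofReal_one]
    exact (ENNReal.continuous_ofReal.tendsto 1).comp
      ((tendsto_integral_inverseMomentIntegrand (NNReal.coe_pos.mpr hθs)).comp
        (NNReal.continuous_coe.tendsto θs))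
  obtain ⟨S, hS, hSo, hSθ⟩ := eventually_nhds_iff.mp
    ((hlim.eventually (gt_mem_nhds hm1)).and (lt_mem_nhds hθs))
  refine ⟨S, hSo.measurableSet, (hfull S hSo ⟨θs, hSθ⟩).ne', (k ^ (1 / 4 : ℝ))⁻¹ * m, ?_, ?_⟩
  · rw [mul_comm, ← div_eq_mul_inv]
    exact ENNReal.div_lt_of_lt_mul (by simpa using hmk)
  · intro θ hθ
    have hk0 : k ≠ 0 := (zero_lt_one.trans hk).ne'
    simp_rw [ENNReal.mul_inv (Or.inl hk0) (Or.inl hkt),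
      ENNReal.mul_rpow_of_nonneg _ _ (show (0 : ℝ) ≤ 1 / 4 by norm_num)]
    rw [lintegral_const_mul' _ _ (by
      rw [ENNReal.inv_rpow]
      exact ENNReal.inv_ne_top.mpr (zero_lt_one.trans hkq).ne'), ENNReal.inv_rpow,
      lintegral_inverse_ratio_cosineDensity hθs (hS θ hθ).2]
    gcongr
    exact (hS θ hθ).1.le

/-! ### `L²` geometry and identifiability of the cosine densities. -/

theorem integral_modelMeasure_cosineDensity (θ : ℝ≥0) (g : ℝ → ℝ) :
    ∫ y, g y ∂(modelMeasure cosineDensity θ) = ∫ y in (0 : ℝ)..1,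
      (1 + Real.cos ((θ : ℝ) * y)) / (1 + Real.sinc (θ : ℝ)) * g y := by
  rw [modelMeasure, integral_withDensity_eq_integral_toReal_smul
    (measurable_density measurable_cosineDensity θ).ennreal_ofReal
    (Eventually.of_forall fun _ => ENNReal.ofReal_lt_top),
    intervalIntegral.integral_of_le zero_le_one, ← integral_Icc_eq_integral_Ioc,
    ← integral_indicator measurableSet_Icc]
  refine integral_congr_ae (Eventually.of_forall fun y => ?_)
  dsimp only
  rw [ENNReal.toReal_ofReal (cosineDensity_nonneg θ y), smul_eq_mul]
  by_cases hy : y ∈ Set.Icc (0 : ℝ) 1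
  · rw [cosineDensity_of_mem θ hy, Set.indicator_of_mem hy]
  · rw [cosineDensity_of_notMem θ hy, Set.indicator_of_notMem hy, zero_mul]

/-- The inner product in `L²` of two cosine densities. -/
noncomputable def cosineInner (a b : ℝ) : ℝ :=
  (1 + Real.sinc a + Real.sinc b + (Real.sinc (a + b) + Real.sinc (a - b)) / 2) /
    ((1 + Real.sinc a) * (1 + Real.sinc b))

theorem integral_mul_eq_cosineInner (a b : ℝ) :
    ∫ y in (0 : ℝ)..1, (1 + Real.cos (a * y)) / (1 + Real.sinc a) *
      ((1 + Real.cos (b * y)) / (1 + Real.sinc b)) = cosineInner a b := by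
  have hI : ∀ t : ℝ, IntervalIntegrable (fun y => 1 + Real.cos (t * y)) volume 0 1 :=
    fun t => Continuous.intervalIntegrable (by fun_prop) _ _
  have h : ∀ y : ℝ, (1 + Real.cos (a * y)) / (1 + Real.sinc a) *
      ((1 + Real.cos (b * y)) / (1 + Real.sinc b)) =
      ((1 + Real.cos (a * y)) + (1 + Real.cos (b * y)) + ((1 / 2) * (1 + Real.cos ((a + b) * y))
        + (1 / 2) * (1 + Real.cos ((a - b) * y))) - 2) /
        ((1 + Real.sinc a) * (1 + Real.sinc b)) := by
    intro y
    rw [div_mul_div_comm, add_mul a b, sub_mul a b, Real.cos_add, Real.cos_sub]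
    ring
  simp_rw [h]
  rw [intervalIntegral.integral_div, intervalIntegral.integral_sub
    (((hI a).add (hI b)).add (((hI _).const_mul _).add ((hI _).const_mul _)))
    intervalIntegrable_const, intervalIntegral.integral_add ((hI a).add (hI b))
    (((hI _).const_mul _).add ((hI _).const_mul _)), intervalIntegral.integral_add (hI a) (hI b),
    intervalIntegral.integral_add ((hI _).const_mul _) ((hI _).const_mul _),
    intervalIntegral.integral_const_mul, intervalIntegral.integral_const_mul]
  simp_rw [integral_one_add_cos_mul]
  rw [cosineInner]
  congr 1
  simp
  ring

theorem integral_cosineDensity (θ₀ θ : ℝ≥0) :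
    ∫ y, cosineDensity θ₀ y ∂(modelMeasure cosineDensity θ) = cosineInner θ θ₀ := by
  rw [integral_modelMeasure_cosineDensity, ← integral_mul_eq_cosineInner]
  refine intervalIntegral.integral_congr fun y hy => ?_
  rw [Set.uIcc_of_le zero_le_one] at hy
  simp only [cosineDensity_of_mem θ₀ hy]

theorem continuous_cosineInner_left (b : ℝ) : Continuous fun a => cosineInner a b := by
  have hc := Real.continuous_sinc
  unfold cosineInner
  refine Continuous.div (by fun_prop) (by fun_prop) fun a => ?_
  exact (mul_pos (one_add_sinc_pos a) (one_add_sinc_pos b)).ne'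

theorem tendsto_sinc_atTop : Tendsto Real.sinc atTop (𝓝 0) := by
  refine squeeze_zero_norm' ?_ tendsto_inv_atTop_zero
  filter_upwards [eventually_gt_atTop 0] with x hx
  rw [Real.sinc_of_ne_zero hx.ne', norm_div, Real.norm_of_nonneg hx.le, ← one_div]
  gcongr
  exact Real.abs_sin_le_one x

theorem tendsto_cosineInner_atTop (b : ℝ) :
    Tendsto (fun a => cosineInner a b) atTop (𝓝 1) := by
  have hb := one_add_sinc_pos b
  have h0 := tendsto_sinc_atTop
  have h1 : Tendsto (fun a => Real.sinc (a + b)) atTop (𝓝 0) :=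
    h0.comp (tendsto_atTop_add_const_right _ b tendsto_id)
  have h2 : Tendsto (fun a => Real.sinc (a - b)) atTop (𝓝 0) := by
    simpa only [sub_eq_add_neg] using! h0.comp (tendsto_atTop_add_const_right _ (-b) tendsto_id)
  have h3 := (((h0.const_add 1).add_const (Real.sinc b)).add ((h1.add h2).div_const 2)).div
    ((h0.const_add 1).mul_const (1 + Real.sinc b)) (by simpa using hb.ne')
  have h4 : (1 + 0 + Real.sinc b + (0 + 0) / 2) / ((1 + 0) * (1 + Real.sinc b)) = 1 := by
    rw [div_eq_one_iff_eq (by simpa using hb.ne')]; ring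
  rwa [h4] at h3

theorem cosineInner_zero_left (b : ℝ) : cosineInner 0 b = 1 := by
  have hb := one_add_sinc_pos b
  rw [cosineInner, div_eq_one_iff_eq (by simpa using hb.ne')]
  simp; ring

/-- The value at `0` determines the normalizing constant; after that, injectivity of the cosine on
`[0, π]` determines the frequency. -/
theorem exists_cosine_density_ne {a b : ℝ} (ha : 0 ≤ a) (hb : 0 ≤ b) (hab : a ≠ b) :
    ∃ y ∈ Set.Icc (0 : ℝ) 1, (1 + Real.cos (a * y)) / (1 + Real.sinc a) ≠
      (1 + Real.cos (b * y)) / (1 + Real.sinc b) := by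
  by_contra! h
  have hca := one_add_sinc_pos a
  have hcb := one_add_sinc_pos b
  have h0 := h 0 (by simp)
  simp only [mul_zero, Real.cos_zero] at h0
  have hc : 1 + Real.sinc a = 1 + Real.sinc b := by
    rw [div_eq_div_iff hca.ne' hcb.ne'] at h0
    linarith
  have hpos : 0 < 1 + a + b := by positivity
  -- This choice puts `y` in `[0, 1]` and both `a y` and `b y` in `[0, 1] ⊆ [0, π]`.
  set y := (1 + a + b)⁻¹ with hy
  have hy0 : 0 < y := inv_pos.mpr hpos
  have h1 := h y ⟨hy0.le, inv_le_one_of_one_le₀ (by linarith)⟩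
  rw [hc, div_left_inj' hcb.ne'] at h1
  have hle : ∀ t, 0 ≤ t → t ≤ 1 + a + b → t * y ∈ Set.Icc 0 Real.pi := by
    intro t ht ht'
    refine ⟨by positivity, ?_⟩
    have : t * y ≤ 1 := by
      rw [hy, ← div_eq_mul_inv]
      exact (div_le_one hpos).mpr ht'
    linarith [Real.pi_gt_three]
  have h2 := Real.injOn_cos (hle a ha (by linarith)) (hle b hb (by linarith))
    (by linarith : Real.cos (a * y) = Real.cos (b * y))
  exact hab (mul_right_cancel₀ hy0.ne' h2)

/-- The expression is the squared `L²` distance of the two densities, and also the gap between the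
means of `f_a - f_b` under `a` and `b`. -/
theorem cosineInner_sub_pos {a b : ℝ} (ha : 0 ≤ a) (hb : 0 ≤ b) (hab : a ≠ b) :
    0 < cosineInner a a - cosineInner a b - (cosineInner b a - cosineInner b b) := by
  set u : ℝ → ℝ → ℝ := fun t y => (1 + Real.cos (t * y)) / (1 + Real.sinc t) with hu
  have huc : ∀ t, Continuous (u t) := fun t => by fun_prop
  have hI : ∀ s t, IntervalIntegrable (fun y => u s y * u t y) volume 0 1 :=
    fun s t => ((huc s).mul (huc t)).intervalIntegrable _ _
  have h1 : ∀ s t, cosineInner s t = ∫ y in (0 : ℝ)..1, u s y * u t y :=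
    fun s t => (integral_mul_eq_cosineInner s t).symm
  have h2 : cosineInner a a - cosineInner a b - (cosineInner b a - cosineInner b b) =
      ∫ y in (0 : ℝ)..1, (u a y - u b y) ^ 2 := by
    rw [h1, h1, h1, h1, ← intervalIntegral.integral_sub (hI _ _) (hI _ _),
      ← intervalIntegral.integral_sub (hI _ _) (hI _ _),
      ← intervalIntegral.integral_sub ((hI _ _).sub (hI _ _)) ((hI _ _).sub (hI _ _))]
    refine intervalIntegral.integral_congr fun y _ => ?_
    ring
  rw [h2]
  obtain ⟨y, hy, hne⟩ := exists_cosine_density_ne ha hb hab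
  refine intervalIntegral.integral_pos zero_lt_one (by fun_prop) (fun _ _ => sq_nonneg _)
    ⟨y, hy, ?_⟩
  have : u a y - u b y ≠ 0 := sub_ne_zero.mpr hne
  positivity

theorem cosineDensity_le (θ : ℝ≥0) (y : ℝ) :
    cosineDensity θ y ≤ 2 / (1 + Real.sinc (θ : ℝ)) := by
  have hc := one_add_sinc_pos (θ : ℝ)
  by_cases hy : y ∈ Set.Icc (0 : ℝ) 1
  · rw [cosineDensity_of_mem θ hy]
    gcongr
    linarith [Real.cos_le_one ((θ : ℝ) * y)]
  · rw [cosineDensity_of_notMem θ hy]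
    positivity

theorem integrable_cosineDensity (θ₀ θ : ℝ≥0) :
    Integrable (cosineDensity θ₀) (modelMeasure cosineDensity θ) :=
  Integrable.of_bound (measurable_density measurable_cosineDensity θ₀).aestronglyMeasurable
    (2 / (1 + Real.sinc (θ₀ : ℝ))) (Eventually.of_forall fun y => by
      rw [Real.norm_of_nonneg (cosineDensity_nonneg θ₀ y)]
      exact cosineDensity_le θ₀ y)

/-! ### Exponential decay away from the true parameter. -/

theorem exponentiallySmallOn_cosineDensity {prior : Measure ℝ≥0} [IsProbabilityMeasure prior]
    {θs θ₀ : ℝ≥0} {S : Set ℝ≥0} (hS : MeasurableSet S) {η : ℝ} (hη : 0 < η)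
    (h : ∀ θ ∈ S, cosineInner θs θ₀ - cosineInner θs θs + η ≤
      cosineInner θ θ₀ - cosineInner θ θs) :
    ExponentiallySmallOn cosineDensity prior θs S := by
  -- The first two terms bound the test function; adding `η` ensures that the rescaled gap is at
  -- most `1`.
  set M : ℝ := 2 / (1 + Real.sinc (θ₀ : ℝ)) + 2 / (1 + Real.sinc (θs : ℝ)) + η with hM
  have hc := one_add_sinc_pos (θ₀ : ℝ)
  have hcs := one_add_sinc_pos (θs : ℝ)
  have hM0 : 0 < M := by positivity
  have hηM : η ≤ M := by
    have : 0 < 2 / (1 + Real.sinc (θ₀ : ℝ)) + 2 / (1 + Real.sinc (θs : ℝ)) := by positivity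
    linarith
  have hE : ∀ θ : ℝ≥0, ∫ y, (cosineDensity θ₀ y - cosineDensity θs y) / M
      ∂(modelMeasure cosineDensity θ) = (cosineInner θ θ₀ - cosineInner θ θs) / M := by
    intro θ
    rw [integral_div, integral_sub (integrable_cosineDensity _ _) (integrable_cosineDensity _ _),
      integral_cosineDensity, integral_cosineDensity]
  refine ExponentiallySmallOn.of_separated measurable_cosineDensity hS
    (g := fun y => (cosineDensity θ₀ y - cosineDensity θs y) / M) (δ := η / M / 2)
    (((measurable_density measurable_cosineDensity θ₀).sub
      (measurable_density measurable_cosineDensity θs)).div_const M) ?_ (by positivity) ?_ ?_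
  · intro y
    rw [abs_div, abs_of_pos hM0, div_le_one hM0, abs_le]
    have h1 := cosineDensity_le θ₀ y
    have h2 := cosineDensity_le θs y
    have h3 := cosineDensity_nonneg θ₀ y
    have h4 := cosineDensity_nonneg θs y
    have h5 : 0 < 2 / (1 + Real.sinc (θ₀ : ℝ)) := by positivity
    have h6 : 0 < 2 / (1 + Real.sinc (θs : ℝ)) := by positivity
    constructor <;> linarith
  · have := (div_le_one hM0).mpr hηM
    linarith
  · intro θ hθ
    rw [hE, hE, mul_div_cancel₀ _ two_ne_zero, ← add_div]
    gcongr
    exact h θ hθ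

theorem exists_mem_nhds_exponentiallySmallOn (prior : Measure ℝ≥0) [IsProbabilityMeasure prior]
    {θs θ₀ : ℝ≥0} (hne : θ₀ ≠ θs) :
    ∃ S ∈ 𝓝 θ₀, ExponentiallySmallOn cosineDensity prior θs S := by
  set D : ℝ := cosineInner θ₀ θ₀ - cosineInner θ₀ θs -
    (cosineInner θs θ₀ - cosineInner θs θs) with hD
  have hD0 : 0 < D := cosineInner_sub_pos θ₀.2 θs.2 (by exact_mod_cast hne)
  have hcont : Continuous fun θ : ℝ≥0 => cosineInner θ θ₀ - cosineInner θ θs :=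
    ((continuous_cosineInner_left θ₀).sub (continuous_cosineInner_left θs)).comp
      NNReal.continuous_coe
  refine ⟨{θ | cosineInner θs θ₀ - cosineInner θs θs + D / 2 <
    cosineInner θ θ₀ - cosineInner θ θs}, ?_, ?_⟩
  · exact (isOpen_lt continuous_const hcont).mem_nhds (by simp only [Set.mem_ofPred_eq]; linarith)
  · exact exponentiallySmallOn_cosineDensity (isOpen_lt continuous_const hcont).measurableSet
      (half_pos hD0) fun θ hθ => le_of_lt hθ

/-- The test function `f_0 - f_θs` has mean tending to `0` as `θ → ∞`, but mean `-‖f_0 - f_θs‖² < 0`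
under `θs`. -/
theorem exists_exponentiallySmallOn_Ici (prior : Measure ℝ≥0) [IsProbabilityMeasure prior]
    {θs : ℝ≥0} (hθs : 0 < θs) :
    ∃ T : ℝ≥0, ExponentiallySmallOn cosineDensity prior θs (Set.Ici T) := by
  have hD0 := cosineInner_sub_pos le_rfl θs.2 (show (0 : ℝ) ≠ θs from (NNReal.coe_pos.mpr hθs).ne)
  simp only [NNReal.val_eq_coe, cosineInner_zero_left, sub_self] at hD0
  have hlim : Tendsto (fun θ : ℝ≥0 => cosineInner θ (0 : ℝ≥0) - cosineInner θ θs) atTop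
      (𝓝 (1 - 1)) :=
    ((tendsto_cosineInner_atTop _).sub (tendsto_cosineInner_atTop _)).comp
      (NNReal.tendsto_coe_atTop.mpr tendsto_id)
  rw [sub_self] at hlim
  set η := (cosineInner θs θs - cosineInner θs 0) / 2 with hη
  have hη0 : 0 < η := by linarith
  obtain ⟨T, hT⟩ := eventually_atTop.mp (hlim.eventually (lt_mem_nhds (neg_lt_zero.mpr hη0)))
  refine ⟨T, exponentiallySmallOn_cosineDensity (θ₀ := 0) measurableSet_Ici hη0 fun θ hθ => ?_⟩
  have := hT θ hθ
  rw [NNReal.coe_zero] at this ⊢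
  linarith

theorem exponentiallySmallOn_compl_ball (prior : Measure ℝ≥0) [IsProbabilityMeasure prior]
    {θs : ℝ≥0} (hθs : 0 < θs) {ε : ℝ} (hε : 0 < ε) :
    ExponentiallySmallOn cosineDensity prior θs {θ | dist θ θs < ε}ᶜ := by
  obtain ⟨T, hT⟩ := exists_exponentiallySmallOn_Ici prior hθs
  have hcomp : IsCompact (Set.Icc 0 T ∩ (Metric.ball θs ε)ᶜ) :=
    isCompact_Icc.inter_right Metric.isOpen_ball.isClosed_compl
  have h : ExponentiallySmallOn cosineDensity prior θs (Set.Icc 0 T ∩ (Metric.ball θs ε)ᶜ) := by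
    -- Exponential smallness is stable under subsets and finite unions, so the local statement
    -- suffices on a compact set.
    refine hcomp.induction_on ExponentiallySmallOn.empty (fun _ _ hst ht => ht.mono hst)
      (fun _ _ hs ht => hs.union ht) fun θ₀ hθ₀ => ?_
    obtain ⟨S, hS, hSmall⟩ := exists_mem_nhds_exponentiallySmallOn prior (θs := θs) (θ₀ := θ₀)
      (by rintro rfl; exact hθ₀.2 (Metric.mem_ball_self hε))
    exact ⟨S, mem_nhdsWithin_of_mem_nhds hS, hSmall⟩
  refine (h.union hT).mono fun θ hθ => ?_
  rcases le_total θ T with h1 | h1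
  · exact Or.inl ⟨⟨zero_le, h1⟩, hθ⟩
  · exact Or.inr h1

/-! ### Positivity of the normalizing constant, and conclusion. -/

theorem continuous_likelihood_cosineDensity (x : ℕ → ℝ) (n : ℕ) :
    Continuous (likelihood cosineDensity x n) := by
  have hc := Real.continuous_sinc
  have h : likelihood cosineDensity x n = fun θ =>
      ENNReal.ofReal (∏ i ∈ Finset.range n, cosineDensity θ (x i)) := by
    funext θ
    exact (ENNReal.ofReal_prod_of_nonneg fun i _ => cosineDensity_nonneg θ (x i)).symm
  rw [h]
  refine ENNReal.continuous_ofReal.comp (continuous_finsetProd _ fun i _ => ?_)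
  by_cases hx : x i ∈ Set.Icc (0 : ℝ) 1
  · simp_rw [cosineDensity_of_mem _ hx]
    refine Continuous.div (by fun_prop) (by fun_prop) fun θ => (one_add_sinc_pos _).ne'
  · simp_rw [cosineDensity_of_notMem _ hx]
    exact continuous_const

/-- The likelihood is continuous in `θ` and positive at `θs`, hence positive on an open set, which
is charged by the prior. -/
theorem lintegral_likelihood_cosineDensity_ne_zero (prior : Measure ℝ≥0)
    (hfull : ∀ U : Set ℝ≥0, IsOpen U → U.Nonempty → 0 < prior U) {θs : ℝ≥0} {x : ℕ → ℝ}
    (hx : ∀ i, 0 < cosineDensity θs (x i)) (n : ℕ) :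
    ∫⁻ θ, likelihood cosineDensity x n θ ∂prior ≠ 0 := by
  have hc := continuous_likelihood_cosineDensity x n
  have hU := hfull {θ | 0 < likelihood cosineDensity x n θ} (isOpen_lt continuous_const hc)
    ⟨θs, pos_iff_ne_zero.mpr (likelihood_ne_zero hx n)⟩
  rw [Ne, lintegral_eq_zero_iff hc.measurable]
  intro h
  refine hU.ne' ?_
  simpa [Filter.EventuallyEq, ae_iff, pos_iff_ne_zero] using h

theorem mainTheorem6 (prior : Measure ℝ≥0) [IsProbabilityMeasure prior]
    (hfull : ∀ U : Set ℝ≥0, IsOpen U → U.Nonempty → 0 < prior U)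
    (θs : ℝ≥0) (hθs : 0 < θs) :
    (∀ᵐ x ∂(Measure.infinitePi fun _ : ℕ => modelMeasure cosineDensity θs),
      ∀ n : ℕ, IsProbabilityMeasure (bayesPosterior cosineDensity prior x n)) ∧
    PosteriorConsistentAt cosineDensity prior θs :=
  ⟨ae_isProbabilityMeasure_bayesPosterior measurable_cosineDensity prior θs
      fun _ hx n => lintegral_likelihood_cosineDensity_ne_zero prior hfull hx n,
    posteriorConsistentAt_of_exponentiallySmallOn measurable_cosineDensity prior θs
      (s := 1 / 4) (by norm_num) (fun _ hε => exponentiallySmallOn_compl_ball prior hθs hε)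
      fun _ hk hkt => exists_inverse_moment_cosineDensity_le prior hfull hθs hk hkt⟩
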